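/- Let $p,n$ be natural numbers, $Q=\{1,\dots,p\}$, and for each $q\in Q$ let $f_q:\mathbb{R}^n\to\mathbb{R}$ be a (finite) convex function and $C_q\subset\mathbb{R}^n$ a nonempty closed convex set. Put $M_q(x)=\partial f_q(x)+N_{C_q}(x)$, where $$\partial f_q(x)=\{y\in\mathbb{R}^n : f_q(x')\ge f_q(x)+y\cdot(x'-x)\ \ \forall x'\in\mathbb{R}^n\}$$ is the convex subdifferential and $$N_{C_q}(x)=\{v\in\mathbb{R}^n : v\cdot(x'-x)\le 0\ \ \forall x'\in C_q\}\ \text{ if } x\in C_q,\qquad N_{C_q}(x)=\emptyset\ \text{ if } x\notin C_q,$$ is the normal cone. A switching signal is a function $\sigma:[0,\infty)\to Q$ for which there is a sequence $0=t_0<t_1<t_2<\cdots$ such that $\sigma$ is constant on $[t_j,t_{j+1})$ for every $j=0,1,2,\dots$. Given a switching signal $\sigma$, a complete solution of the switching system $\dot x\in -M_\sigma(x)$ is a locally absolutely continuous function $\phi:[0,\infty)\to\mathbb{R}^n$ such that $\dot\phi(t)\in -M_{\sigma(t)}(\phi(t))$ for almost every $t\in[0,\infty)$. Assume that the set of common constrained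 minimizers $$A=\bigcap_{q\in Q}\operatorname*{arg\,min}_{x\in C_q} f_q(x)$$ is nonempty, and let $\sigma$ be a switching signal such that $\mu(\{t\in[0,\infty) : \sigma(t)=q\})=\infty$ for every $q\in Q$, where $\mu$ is Lebesgue (outer) measure. Then for every complete solution $\phi$, the limit $\lim_{t\to\infty}\phi(t)$ exists and belongs to $A$. -/

import Mathlib

open Set Filter Topology MeasureTheory
open scoped Pointwise

namespace SwitchingDescent

/-- The convex subdifferential of a finite function `g` at `x`. -/
def subdifferential {E : Type*} [NormedAddCommGroup E] [InnerProductSpace ℝ E]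
    (g : E → ℝ) (x : E) : Set E :=
  {y | ∀ x' : E, g x + inner ℝ y (x' - x) ≤ g x'}

/-- The normal cone to `D` at `x`; it is empty when `x` is not in `D`. -/
def normalCone {E : Type*} [NormedAddCommGroup E] [InnerProductSpace ℝ E]
    (D : Set E) (x : E) : Set E :=
  {v | x ∈ D ∧ ∀ x' ∈ D, inner ℝ v (x' - x) ≤ 0}

/-- The set of minimizers of `g` over `D`. -/
def argminOn {E : Type*} (g : E → ℝ) (D : Set E) : Set E :=
  {x | x ∈ D ∧ ∀ x' ∈ D, g x ≤ g x'}

/-- The set-valued mapping `M_q(x) = ∂f_q(x) + N_{C_q}(x)` (Minkowski sum of sets). -/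
def modeMap {p n : ℕ} (f : Fin p → EuclideanSpace ℝ (Fin n) → ℝ)
    (C : Fin p → Set (EuclideanSpace ℝ (Fin n))) (q : Fin p)
    (x : EuclideanSpace ℝ (Fin n)) : Set (EuclideanSpace ℝ (Fin n)) :=
  subdifferential (f q) x + normalCone (C q) x

/-- The set of common constrained minimizers. -/
def commonMinimizers {p n : ℕ} (f : Fin p → EuclideanSpace ℝ (Fin n) → ℝ)
    (C : Fin p → Set (EuclideanSpace ℝ (Fin n))) : Set (EuclideanSpace ℝ (Fin n)) :=
  ⋂ q, argminOn (f q) (C q)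

/-- Switching signals on `[0, ∞)`; the values at negative times are irrelevant. -/
def IsSwitchingSignal {p : ℕ} (σ : ℝ → Fin p) : Prop :=
  ∃ t : ℕ → ℝ, t 0 = 0 ∧ StrictMono t ∧
    ∀ j, ∀ s ∈ Ico (t j) (t (j + 1)), σ s = σ (t j)

/-- The set of times in `[0, ∞)` at which the mode `q` is active. -/
def activeTimes {p : ℕ} (σ : ℝ → Fin p) (q : Fin p) : Set ℝ :=
  {t | 0 ≤ t ∧ σ t = q}

/-- Local absolute continuity on an interval `I`: absolute continuity on each compact
subinterval. -/
def LocallyAbsolutelyContinuousOn {E : Type*} [SeminormedAddCommGroup E]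
    (φ : ℝ → E) (I : Set ℝ) : Prop :=
  ∀ a ∈ I, ∀ b ∈ I, a ≤ b → AbsolutelyContinuousOnInterval φ a b

/-- `φ`, considered on the domain `I` only, is a solution of `φ' ∈ -M_σ(φ)`. -/
structure IsSolution {p n : ℕ} (f : Fin p → EuclideanSpace ℝ (Fin n) → ℝ)
    (C : Fin p → Set (EuclideanSpace ℝ (Fin n))) (σ : ℝ → Fin p) (I : Set ℝ)
    (φ : ℝ → EuclideanSpace ℝ (Fin n)) : Prop where
  dom : (∃ T : ℝ, 0 < T ∧ I = Ico 0 T) ∨ (∃ T : ℝ, 0 ≤ T ∧ I = Icc 0 T) ∨ I = Ici 0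
  locallyAbsolutelyContinuous : LocallyAbsolutelyContinuousOn φ I
  inclusion : ∀ᵐ t ∂(volume.restrict I),
    ∃ v, HasDerivWithinAt φ v I t ∧ v ∈ -modeMap f C (σ t) (φ t)

/-- A solution is complete if its domain is `[0, ∞)`. -/
def IsCompleteSolution {p n : ℕ} (f : Fin p → EuclideanSpace ℝ (Fin n) → ℝ)
    (C : Fin p → Set (EuclideanSpace ℝ (Fin n))) (σ : ℝ → Fin p)
    (φ : ℝ → EuclideanSpace ℝ (Fin n)) : Prop :=
  IsSolution f C σ (Ici 0) φ

end SwitchingDescent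

namespace SwitchingDescent

/-! ### Absolutely continuous functions with signed derivative. -/

section AbsolutelyContinuous

variable {E : Type*} [NormedAddCommGroup E]

/-! For `a` in the common minimizers, `‖φ - a‖` is nonincreasing, so `φ` is bounded and has a
cluster point `x`. Since `x` is not yet known to be a common minimizer, its distance to `φ` need not
be monotone. But modes minimized at `x` do not increase that distance, while near `x` the others
have an optimality gap and decrease `‖φ - a‖ ^ 2` at a definite rate. As speeds are bounded
(`ae_descent`, `exists_bound_subdifferential`), a large multiple of that decrease pays for any drift
away from `x`: `exists_local_lyapunov`. This traps `φ` near `x`. If the limit were not optimal for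
mode `q`, the gap would make `‖φ - a‖ ^ 2` drop at a fixed rate during an infinite time. -/

theorem absolutelyContinuousOnInterval_norm_sub_sq {φ : ℝ → E} {a b : ℝ}
    (h : AbsolutelyContinuousOnInterval φ a b) (x : E) :
    AbsolutelyContinuousOnInterval (fun t => ‖φ t - x‖ ^ 2) a b := by
  have key : AbsolutelyContinuousOnInterval (fun t => ‖φ t - x‖) a b := by
    unfold AbsolutelyContinuousOnInterval at h ⊢
    refine squeeze_zero (fun _ => Finset.sum_nonneg fun _ _ => dist_nonneg) (fun I => ?_) h
    refine Finset.sum_le_sum fun i _ => ?_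
    rw [Real.dist_eq, dist_eq_norm]
    refine (abs_norm_sub_norm_le _ _).trans_eq ?_
    congr 1
    abel
  have h2 := key.fun_mul key
  simpa only [pow_two] using h2

theorem le_of_ae_hasDerivAt_nonpos {g : ℝ → ℝ} {a b : ℝ} (hab : a ≤ b)
    (hg : AbsolutelyContinuousOnInterval g a b)
    (h : ∀ᵐ t, t ∈ Ioo a b → ∃ d ≤ 0, HasDerivAt g d t) : g b ≤ g a := by
  have h1 := hg.integral_deriv_eq_sub
  have h2 : ∀ᵐ t ∂(volume.restrict (Ioc a b)), deriv g t ≤ 0 := by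
    rw [ae_restrict_iff' measurableSet_Ioc]
    have hb : ∀ᵐ t : ℝ, t ≠ b := by simp [ae_iff, measure_singleton]
    filter_upwards [h, hb] with t ht htb htm
    obtain ⟨d, hd, hd'⟩ := ht ⟨htm.1, lt_of_le_of_ne htm.2 htb⟩
    rwa [hd'.deriv]
  have h3 : ∫ t in a..b, deriv g t ≤ 0 := by
    rw [intervalIntegral.integral_of_le hab]
    exact integral_nonpos_of_ae h2
  linarith

/-- Markov's inequality for the derivative of a nonincreasing absolutely continuous function;
the set `S` need not be measurable. -/
theorem volume_le_of_ae_hasDerivAt_le {g : ℝ → ℝ} {a b δ : ℝ} (hab : a ≤ b) (hδ : 0 < δ)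
    (hg : AbsolutelyContinuousOnInterval g a b)
    (h : ∀ᵐ t, t ∈ Ioc a b → ∃ d ≤ 0, HasDerivAt g d t) {S : Set ℝ} (hS : S ⊆ Ioc a b)
    (hSd : ∀ᵐ t, t ∈ S → ∃ d ≤ -δ, HasDerivAt g d t) :
    volume S ≤ ENNReal.ofReal ((g a - g b) / δ) := by
  have h1 := hg.integral_deriv_eq_sub
  rw [intervalIntegral.integral_of_le hab] at h1
  have hint : IntegrableOn (fun t => -deriv g t) (Ioc a b) volume :=
    ((intervalIntegrable_iff_integrableOn_Ioc_of_le hab).1 hg.intervalIntegrable_deriv).neg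
  have hnn : 0 ≤ᵐ[volume.restrict (Ioc a b)] fun t => -deriv g t := by
    rw [EventuallyLE, ae_restrict_iff' measurableSet_Ioc]
    filter_upwards [h] with t ht htm
    obtain ⟨d, hd, hd'⟩ := ht htm
    simpa [hd'.deriv] using hd
  have hM := mul_meas_ge_le_integral_of_nonneg hnn hint δ
  rw [integral_neg, h1, neg_sub] at hM
  -- A measurable set containing almost all of `S`, so that only outer measure is needed for `S`.
  set T : Set ℝ := {t | δ ≤ -deriv g t} with hT
  have hTm : MeasurableSet T := measurableSet_le measurable_const (measurable_deriv g).neg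
  have hsub : volume S ≤ (volume.restrict (Ioc a b)) T := by
    rw [Measure.restrict_apply hTm]
    refine measure_mono_ae ?_
    filter_upwards [hSd] with t ht htS
    obtain ⟨d, hd, hd'⟩ := ht htS
    refine ⟨?_, hS htS⟩
    change δ ≤ -deriv g t
    rw [hd'.deriv]
    linarith
  have hfin : (volume.restrict (Ioc a b)) T ≠ ⊤ := measure_ne_top _ _
  refine hsub.trans ?_
  rw [← ENNReal.ofReal_toReal hfin]
  refine ENNReal.ofReal_le_ofReal ?_
  rw [le_div_iff₀ hδ, mul_comm]
  exact hM

end AbsolutelyContinuous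

/-- Points outside the constrained minimizers have a neighbourhood on which the constrained
suboptimality is bounded away from zero. -/
theorem exists_gap_of_notMem_argminOn {X : Type*} [TopologicalSpace X] {g : X → ℝ}
    (hg : Continuous g) {D : Set X} (hD : IsClosed D) {a x : X} (ha : a ∈ argminOn g D) (hx : x ∉ argminOn g D) :
    ∃ δ > 0, ∀ᶠ u in 𝓝 x, u ∈ D → g a + δ ≤ g u := by
  by_cases hxD : x ∈ D
  · have hlt : g a < g x := by
      by_contra! hcon
      exact hx ⟨hxD, fun x' hx' => hcon.trans (ha.2 x' hx')⟩
    refine ⟨(g x - g a) / 2, by linarith, ?_⟩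
    filter_upwards [hg.continuousAt.eventually
      (lt_mem_nhds (show (g x + g a) / 2 < g x by linarith))] with u hu _
    linarith
  · refine ⟨1, one_pos, ?_⟩
    filter_upwards [hD.isOpen_compl.mem_nhds hxD] with u hu hu'
    exact absurd hu' hu

/-! ### Subgradient bounds and local domination. -/

section InnerProductSpace

variable {E : Type*} [NormedAddCommGroup E] [InnerProductSpace ℝ E]

theorem hasDerivAt_norm_sub_sq {φ : ℝ → E} {w : E} {t : ℝ} (h : HasDerivAt φ w t) (x : E) :
    HasDerivAt (fun s => ‖φ s - x‖ ^ 2) (2 * inner ℝ w (φ t - x)) t := by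
  have := (h.sub_const x).norm_sq
  rwa [real_inner_comm] at this

/-- Test the subgradient inequality at the unit step from `x` in the direction of `y`. -/
theorem norm_le_of_mem_subdifferential {g : E → ℝ} {x y : E} {B : ℝ}
    (hy : y ∈ subdifferential g x) (hB : ∀ z, ‖z - x‖ ≤ 1 → |g z| ≤ B) : ‖y‖ ≤ 2 * B := by
  have h0 := hB x (by simp)
  by_cases hy0 : y = 0
  · subst hy0
    have := (abs_nonneg _).trans h0
    simpa using this
  have hn : 0 < ‖y‖ := norm_pos_iff.2 hy0
  have h1 := hB (x + ‖y‖⁻¹ • y) (by simp [norm_smul, hn.ne'])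
  have h2 := hy (x + ‖y‖⁻¹ • y)
  rw [add_sub_cancel_left, real_inner_smul_right, real_inner_self_eq_norm_sq, pow_two,
    inv_mul_cancel_left₀ hn.ne'] at h2
  linarith [abs_le.1 h0, abs_le.1 h1]

theorem exists_bound_subdifferential [FiniteDimensional ℝ E] {g : E → ℝ}
    (hg : ConvexOn ℝ univ g) (R : ℝ) :
    ∃ L : ℝ, ∀ x, ‖x‖ ≤ R → ∀ y ∈ subdifferential g x, ‖y‖ ≤ L := by
  have : ProperSpace E := FiniteDimensional.proper_real E
  obtain ⟨B, hB⟩ := (isCompact_closedBall (0 : E) (R + 1)).exists_bound_of_continuousOn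
    hg.locallyLipschitz.continuous.continuousOn
  refine ⟨2 * B, fun x hx y hy => norm_le_of_mem_subdifferential hy fun z hz => ?_⟩
  refine hB z ?_
  rw [mem_closedBall_zero_iff]
  have := norm_add_le (z - x) x
  rw [sub_add_cancel] at this
  linarith

/-- A functional that is maximal at `φ t` among the values of `φ` on a set accumulating at `t`
from both sides is orthogonal to the derivative of `φ` at `t`. -/
theorem inner_deriv_eq_zero_of_accumulation {φ : ℝ → E} {v w : E} {t : ℝ} {S : Set ℝ}
    (h : HasDerivAt φ w t) (hS : ∀ s ∈ S, inner ℝ v (φ s - φ t) ≤ 0)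
    (hr : 𝓝[S ∩ Ioi t] t ≠ ⊥) (hl : 𝓝[S ∩ Iio t] t ≠ ⊥) : inner ℝ v w = 0 := by
  have hd : Tendsto (fun s => inner ℝ v (slope φ t s)) (𝓝[≠] t) (𝓝 (inner ℝ v w)) :=
    tendsto_const_nhds.inner (hasDerivAt_iff_tendsto_slope.1 h)
  have : (𝓝[S ∩ Ioi t] t).NeBot := ⟨hr⟩
  have : (𝓝[S ∩ Iio t] t).NeBot := ⟨hl⟩
  apply le_antisymm
  · refine le_of_tendsto (hd.mono_left (nhdsWithin_mono t
      (show S ∩ Ioi t ⊆ {t}ᶜ from fun s hs => ne_of_gt hs.2))) ?_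
    filter_upwards [self_mem_nhdsWithin] with s hs
    rw [slope_def_module, real_inner_smul_right]
    exact mul_nonpos_of_nonneg_of_nonpos (inv_nonneg.2 (sub_nonneg.2 (le_of_lt hs.2)))
      (hS s hs.1)
  · refine ge_of_tendsto (hd.mono_left (nhdsWithin_mono t
      (show S ∩ Iio t ⊆ {t}ᶜ from fun s hs => ne_of_lt hs.2))) ?_
    filter_upwards [self_mem_nhdsWithin] with s hs
    rw [slope_def_module, real_inner_smul_right]
    exact mul_nonneg_of_nonpos_of_nonpos (inv_nonpos.2 (sub_nonpos.2 (le_of_lt hs.2)))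
      (hS s hs.1)

/-- Near any point `x`, for velocities `w` of bounded norm satisfying the descent inequality, a
possible increase of the distance to `x` is dominated by the decrease of the distance to the
minimizer `a`. -/
theorem exists_local_domination {g : E → ℝ} (hg : Continuous g) {D : Set E}
    (hD : IsClosed D) {a : E} (ha : a ∈ argminOn g D) (x : E) (L : ℝ) :
    ∃ K ≥ 0, ∀ᶠ u in 𝓝 x, u ∈ D → ∀ w : E, ‖w‖ ≤ L →
      (∀ z ∈ D, inner ℝ w (u - z) ≤ g z - g u) →
      inner ℝ w (u - x) + K * inner ℝ w (u - a) ≤ 0 := by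
  by_cases hx : x ∈ argminOn g D
  · refine ⟨0, le_rfl, Eventually.of_forall fun u hu w _ h => ?_⟩
    have h1 := h x hx.1
    have h2 := hx.2 u hu
    linarith
  · obtain ⟨δ, hδ, hev⟩ := exists_gap_of_notMem_argminOn hg hD ha hx
    -- Within distance 1 of `x` the first term is at most `|L|`, and the gap makes `inner ℝ w (u -
    -- a)` at most `-δ`.
    refine ⟨|L| / δ, by positivity, ?_⟩
    filter_upwards [hev, Metric.ball_mem_nhds x one_pos] with u hu hball huD w hw h
    rw [mem_ball_iff_norm] at hball
    have h1 := h a ha.1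
    have h2 := hu huD
    have h3 : inner ℝ w (u - x) ≤ |L| := by
      refine (real_inner_le_norm _ _).trans ?_
      calc ‖w‖ * ‖u - x‖ ≤ |L| * 1 :=
            mul_le_mul (hw.trans (le_abs_self L)) hball.le (norm_nonneg _) (abs_nonneg _)
        _ = |L| := mul_one _
    have h4 : |L| / δ * inner ℝ w (u - a) ≤ |L| / δ * (-δ) :=
      mul_le_mul_of_nonneg_left (by linarith) (by positivity)
    have h5 : |L| / δ * (-δ) = -|L| := by field_simp
    linarith

end InnerProductSpace

/-! ### Descent, convergence and optimality of the limit. -/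

section Solutions

variable {p n : ℕ} {f : Fin p → EuclideanSpace ℝ (Fin n) → ℝ}
  {C : Fin p → Set (EuclideanSpace ℝ (Fin n))} {σ : ℝ → Fin p}
  {φ : ℝ → EuclideanSpace ℝ (Fin n)}

/-- At almost every time the velocity satisfies the descent inequality of the active mode, and
is no larger than some subgradient: it is orthogonal to the normal component, because almost every
time is accumulated from both sides by feasible times of the same mode. -/
theorem IsCompleteSolution.ae_descent (hφ : IsCompleteSolution f C σ φ) :
    ∀ᵐ t, 0 < t → φ t ∈ C (σ t) ∧ ∃ w, HasDerivAt φ w t ∧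
      (∀ z ∈ C (σ t), inner ℝ w (φ t - z) ≤ f (σ t) z - f (σ t) (φ t)) ∧
      ∃ y ∈ subdifferential (f (σ t)) (φ t), ‖w‖ ≤ ‖y‖ := by
  have h1 := (ae_restrict_iff' measurableSet_Ici).1 hφ.inclusion
  let S : Fin p → Set ℝ := fun q => {t | σ t = q ∧ φ t ∈ C q}
  -- The points of any real set that are isolated on one side are countable, hence null.
  have hr : ∀ᵐ t, ∀ q, ¬ (t ∈ S q ∧ 𝓝[S q ∩ Ioi t] t = ⊥) :=
    ae_all_iff.2 fun q => measure_eq_zero_iff_ae_notMem.1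
      ((countable_setOfPred_isolated_right_within (s := S q)).measure_zero volume)
  have hl : ∀ᵐ t, ∀ q, ¬ (t ∈ S q ∧ 𝓝[S q ∩ Iio t] t = ⊥) :=
    ae_all_iff.2 fun q => measure_eq_zero_iff_ae_notMem.1
      ((countable_setOfPred_isolated_left_within (s := S q)).measure_zero volume)
  filter_upwards [h1, hr, hl] with t ht hr hl htpos
  obtain ⟨w, hw, hwM⟩ := ht htpos.le
  have hw' : HasDerivAt φ w t := hw.hasDerivAt (Ici_mem_nhds htpos)
  obtain ⟨y, hy, v, hv, hyv⟩ := Set.mem_add.1 (Set.mem_neg.1 hwM)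
  have hwe : w = -y - v := by rw [← neg_neg w, ← hyv]; abel
  have htS : t ∈ S (σ t) := ⟨rfl, hv.1⟩
  have horth : inner ℝ v w = 0 :=
    inner_deriv_eq_zero_of_accumulation (S := S (σ t)) hw' (fun s hs => hv.2 _ hs.2)
      (fun h => hr _ ⟨htS, h⟩) (fun h => hl _ ⟨htS, h⟩)
  refine ⟨hv.1, w, hw', fun z hz => ?_, y, hy, ?_⟩
  · have h2 := hy z
    have h3 := hv.2 z hz
    have h4 : inner ℝ w (φ t - z) = inner ℝ y (z - φ t) + inner ℝ v (z - φ t) := by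
      rw [← inner_add_left, hyv, ← neg_sub z (φ t), inner_neg_right, inner_neg_left]
    linarith
  · have h2 : ‖w‖ ^ 2 ≤ ‖y‖ * ‖w‖ := by
      have h3 : inner ℝ w w = -inner ℝ y w := by
        have h4 : inner ℝ w w = inner ℝ (-y - v) w := by rw [← hwe]
        rw [h4, inner_sub_left, horth, inner_neg_left, sub_zero]
      rw [← real_inner_self_eq_norm_sq, h3, ← inner_neg_left]
      simpa using real_inner_le_norm (-y) w
    by_contra! hlt
    nlinarith [norm_nonneg y]

theorem IsCompleteSolution.absolutelyContinuousOnInterval (hφ : IsCompleteSolution f C σ φ)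
    {a b : ℝ} (ha : 0 ≤ a) (hab : a ≤ b) : AbsolutelyContinuousOnInterval φ a b :=
  hφ.locallyAbsolutelyContinuous a ha b (ha.trans hab) hab

/-- The squared distance to a common minimizer has a nonpositive derivative almost everywhere. -/
theorem IsCompleteSolution.antitoneOn_norm_sub_sq (hφ : IsCompleteSolution f C σ φ)
    {a : EuclideanSpace ℝ (Fin n)} (ha : a ∈ commonMinimizers f C) :
    AntitoneOn (fun t => ‖φ t - a‖ ^ 2) (Ici 0) := by
  intro s hs t _ hst
  refine le_of_ae_hasDerivAt_nonpos hst (absolutelyContinuousOnInterval_norm_sub_sq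
    (hφ.absolutelyContinuousOnInterval hs hst) a) ?_
  filter_upwards [hφ.ae_descent] with r hr hrm
  obtain ⟨hC, w, hw, hz, -⟩ := hr (lt_of_le_of_lt hs hrm.1)
  refine ⟨_, ?_, hasDerivAt_norm_sub_sq hw a⟩
  have ha' := mem_iInter.1 ha (σ r)
  have h1 := hz a ha'.1
  have h2 := ha'.2 _ hC
  linarith

theorem IsCompleteSolution.continuousOn (hφ : IsCompleteSolution f C σ φ) {a b : ℝ}
    (ha : 0 ≤ a) (hab : a ≤ b) : ContinuousOn φ (Icc a b) := by
  have := (hφ.absolutelyContinuousOnInterval ha hab).continuousOn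
  rwa [uIcc_of_le hab] at this

theorem IsCompleteSolution.exists_norm_le (hφ : IsCompleteSolution f C σ φ)
    (hA : (commonMinimizers f C).Nonempty) : ∃ R, ∀ t, 0 ≤ t → ‖φ t‖ ≤ R := by
  obtain ⟨a, ha⟩ := hA
  refine ⟨‖φ 0 - a‖ + ‖a‖, fun t ht => ?_⟩
  have h1 : ‖φ t - a‖ ^ 2 ≤ ‖φ 0 - a‖ ^ 2 :=
    hφ.antitoneOn_norm_sub_sq ha (mem_Ici.2 le_rfl) ht ht
  have h2 := (sq_le_sq₀ (norm_nonneg _) (norm_nonneg _)).1 h1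
  have h3 := norm_add_le (φ t - a) a
  rw [sub_add_cancel] at h3
  linarith

/-- Around any point `x`, the function `‖φ - x‖ ^ 2 + K * ‖φ - a‖ ^ 2` is nonincreasing as long as
the solution stays close to `x`. -/
theorem IsCompleteSolution.exists_local_lyapunov (hφ : IsCompleteSolution f C σ φ)
    (hf : ∀ q, ConvexOn ℝ univ (f q)) (hC : ∀ q, IsClosed (C q))
    {a : EuclideanSpace ℝ (Fin n)} (ha : a ∈ commonMinimizers f C)
    (x : EuclideanSpace ℝ (Fin n)) :
    ∃ K ≥ 0, ∃ r > 0, ∀ s t, 0 ≤ s → s ≤ t → (∀ τ ∈ Ioo s t, ‖φ τ - x‖ < r) →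
      ‖φ t - x‖ ^ 2 + K * ‖φ t - a‖ ^ 2 ≤ ‖φ s - x‖ ^ 2 + K * ‖φ s - a‖ ^ 2 := by
  obtain ⟨R, hR⟩ := hφ.exists_norm_le ⟨a, ha⟩
  choose L hL using fun q => exists_bound_subdifferential (hf q) R
  have ha' := mem_iInter.1 ha
  choose K hK0 hK using fun q =>
    exists_local_domination (hf q).locallyLipschitz.continuous (hC q) (ha' q) x (L q)
  obtain ⟨r, hr, hball⟩ := Metric.eventually_nhds_iff_ball.1 (eventually_all.2 hK)
  -- One constant serves all modes: enlarging `K` is harmless because its factor is nonpositive.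
  have hKs : ∀ q, K q ≤ ∑ q, K q := fun q =>
    Finset.single_le_sum (fun i _ => hK0 i) (Finset.mem_univ q)
  refine ⟨∑ q, K q, Finset.sum_nonneg fun q _ => hK0 q, r, hr, fun s t hs hst hst' => ?_⟩
  have hac := hφ.absolutelyContinuousOnInterval hs hst
  refine le_of_ae_hasDerivAt_nonpos
    (g := fun τ => ‖φ τ - x‖ ^ 2 + (∑ q, K q) * ‖φ τ - a‖ ^ 2) hst
    ((absolutelyContinuousOnInterval_norm_sub_sq hac x).fun_add
      ((absolutelyContinuousOnInterval_norm_sub_sq hac a).const_mul _)) ?_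
  filter_upwards [hφ.ae_descent] with τ hτ hτm
  have hτ0 : 0 < τ := lt_of_le_of_lt hs hτm.1
  obtain ⟨hCτ, w, hw, hz, y, hy, hwy⟩ := hτ hτ0
  refine ⟨_, ?_, (hasDerivAt_norm_sub_sq hw x).add ((hasDerivAt_norm_sub_sq hw a).const_mul _)⟩
  have h1 := hball (φ τ) (mem_ball_iff_norm.2 (hst' τ hτm)) (σ τ) hCτ w
    (hwy.trans (hL _ _ (hR τ hτ0.le) y hy)) hz
  have h2 : inner ℝ w (φ τ - a) ≤ 0 := by
    have h3 := hz a (ha' (σ τ)).1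
    have h4 := (ha' (σ τ)).2 _ hCτ
    linarith
  have h3 := mul_le_mul_of_nonpos_right (hKs (σ τ)) h2
  linarith

theorem IsCompleteSolution.exists_tendsto (hφ : IsCompleteSolution f C σ φ)
    (hf : ∀ q, ConvexOn ℝ univ (f q)) (hC : ∀ q, IsClosed (C q))
    (hA : (commonMinimizers f C).Nonempty) : ∃ x, Tendsto φ atTop (𝓝 x) := by
  obtain ⟨R, hR⟩ := hφ.exists_norm_le hA
  obtain ⟨a, ha⟩ := hA
  obtain ⟨x, -, hx⟩ : ∃ x ∈ Metric.closedBall (0 : EuclideanSpace ℝ (Fin n)) R,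
      MapClusterPt x atTop φ :=
    (isCompact_closedBall _ _).exists_mapClusterPt_of_frequently
      ((eventually_ge_atTop (0 : ℝ)).mono fun t ht =>
        mem_closedBall_zero_iff.2 (hR t ht)).frequently
  refine ⟨x, ?_⟩
  obtain ⟨K, hK, r, hr, hW⟩ := hφ.exists_local_lyapunov hf hC ha x
  have hanti := hφ.antitoneOn_norm_sub_sq ha
  -- A monotone quantity that drops below its value at a cluster point could never return to it.
  have hlow : ∀ t, 0 ≤ t → ‖x - a‖ ^ 2 ≤ ‖φ t - a‖ ^ 2 := by
    intro t ht
    by_contra! hlt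
    have hc : Continuous fun u : EuclideanSpace ℝ (Fin n) => ‖u - a‖ ^ 2 := by fun_prop
    obtain ⟨s, hs1, hs2⟩ := ((hx.frequently (hc.continuousAt.eventually
      (lt_mem_nhds hlt))).and_eventually (eventually_ge_atTop t)).exists
    exact absurd (hanti ht (ht.trans hs2) hs2) (not_le.2 hs1)
  rw [Metric.tendsto_atTop]
  intro ε hε
  set ρ := min ε r with hρ
  have hρ0 : 0 < ρ := lt_min hε hr
  have hc : Continuous fun u : EuclideanSpace ℝ (Fin n) =>
      ‖u - x‖ ^ 2 + K * ‖u - a‖ ^ 2 := by fun_prop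
  have hlt : ‖x - x‖ ^ 2 + K * ‖x - a‖ ^ 2 < ρ ^ 2 + K * ‖x - a‖ ^ 2 := by
    have := pow_pos hρ0 2
    simpa using this
  obtain ⟨s, hs, hs0⟩ := ((hx.frequently (hc.continuousAt.eventually
    (gt_mem_nhds hlt))).and_eventually (eventually_ge_atTop (0 : ℝ))).exists
  refine ⟨s, fun t hst => ?_⟩
  rw [dist_eq_norm]
  refine lt_of_lt_of_le ?_ (min_le_left ε r)
  by_contra! hcon
  have hcl : IsCompact (Icc s t ∩ (fun τ => ‖φ τ - x‖) ⁻¹' Ici ρ) :=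
    isCompact_Icc.of_isClosed_subset
      (((hφ.continuousOn hs0 hst).sub continuousOn_const).norm.preimage_isClosed_of_isClosed
        isClosed_Icc isClosed_Ici) inter_subset_left
  -- At the first time `τ` of distance at least `ρ`, the Lyapunov value is at least `ρ ^ 2 + K * ‖x
  -- - a‖ ^ 2`, above its value at `s`.
  obtain ⟨τ, ⟨hτm, hτρ⟩, hτ⟩ := hcl.exists_isLeast ⟨t, ⟨hst, le_rfl⟩, hcon⟩
  have h1 := hW s τ hs0 hτm.1 fun u hu => by
    refine lt_of_lt_of_le ?_ (min_le_right ε r)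
    by_contra! hu'
    exact absurd (hτ ⟨⟨hu.1.le, hu.2.le.trans hτm.2⟩, hu'⟩) (not_le.2 hu.2)
  have h2 := mul_le_mul_of_nonneg_left (hlow τ (hs0.trans hτm.1)) hK
  have h3 : ρ ^ 2 ≤ ‖φ τ - x‖ ^ 2 := pow_le_pow_left₀ hρ0.le hτρ 2
  linarith

theorem IsCompleteSolution.mem_argminOn_of_tendsto (hφ : IsCompleteSolution f C σ φ)
    (hf : ∀ q, ConvexOn ℝ univ (f q)) (hC : ∀ q, IsClosed (C q))
    (hA : (commonMinimizers f C).Nonempty) {x : EuclideanSpace ℝ (Fin n)}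
    (hx : Tendsto φ atTop (𝓝 x)) {q : Fin p} (hq : volume (activeTimes σ q) = ⊤) :
    x ∈ argminOn (f q) (C q) := by
  obtain ⟨a, ha⟩ := hA
  have ha' := mem_iInter.1 ha
  by_contra hcon
  obtain ⟨δ, hδ, hev⟩ :=
    exists_gap_of_notMem_argminOn (hf q).locallyLipschitz.continuous (hC q) (ha' q) hcon
  obtain ⟨s, hs⟩ := eventually_atTop.1 ((hx.eventually hev).and (eventually_ge_atTop 0))
  have hs0 : 0 ≤ s := (hs s le_rfl).2
  -- While `q` is active after `s`, `‖φ - a‖ ^ 2` has slope at most `-2δ`; the bound does not depend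
  -- on `k`.
  have hbound : ∀ k : ℕ, volume (activeTimes σ q ∩ Ioc s (s + k)) ≤
      ENNReal.ofReal (‖φ s - a‖ ^ 2 / (2 * δ)) := by
    intro k
    have hk : s ≤ s + k := le_add_of_nonneg_right k.cast_nonneg
    refine (volume_le_of_ae_hasDerivAt_le hk (mul_pos two_pos hδ)
      (absolutelyContinuousOnInterval_norm_sub_sq
        (hφ.absolutelyContinuousOnInterval hs0 hk) a) ?_ inter_subset_right ?_).trans
      (ENNReal.ofReal_le_ofReal ?_)
    · filter_upwards [hφ.ae_descent] with t ht htm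
      obtain ⟨hCt, w, hw, hz, -⟩ := ht (lt_of_le_of_lt hs0 htm.1)
      refine ⟨_, ?_, hasDerivAt_norm_sub_sq hw a⟩
      have h1 := hz a (ha' (σ t)).1
      have h2 := (ha' (σ t)).2 _ hCt
      linarith
    · filter_upwards [hφ.ae_descent] with t ht htm
      obtain ⟨hCt, w, hw, hz, -⟩ := ht (lt_of_le_of_lt hs0 htm.2.1)
      refine ⟨_, ?_, hasDerivAt_norm_sub_sq hw a⟩
      rw [htm.1.2] at hCt hz
      have h1 := hz a (ha' q).1
      have h2 := (hs t htm.2.1.le).1 hCt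
      linarith
    · gcongr
      exact sub_le_self _ (sq_nonneg _)
  have hcover : activeTimes σ q ⊆ Icc 0 s ∪ ⋃ k : ℕ, activeTimes σ q ∩ Ioc s (s + k) := by
    intro t ht
    rcases le_or_gt t s with h | h
    · exact Or.inl ⟨ht.1, h⟩
    · obtain ⟨k, hk⟩ := exists_nat_ge (t - s)
      exact Or.inr (mem_iUnion.2 ⟨k, ht, h, by linarith⟩)
  have hmono : Monotone fun k : ℕ => activeTimes σ q ∩ Ioc s (s + k) := fun k l hkl =>
    inter_subset_inter_right _ (Ioc_subset_Ioc_right (by gcongr))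
  have hlt : volume (activeTimes σ q) < ⊤ := by
    refine (measure_mono hcover).trans_lt ((measure_union_le _ _).trans_lt
      (ENNReal.add_lt_top.2 ⟨measure_Icc_lt_top, ?_⟩))
    rw [hmono.measure_iUnion]
    exact (iSup_le hbound).trans_lt ENNReal.ofReal_lt_top
  exact hlt.ne hq

end Solutions

end SwitchingDescent

theorem theorem1 {p n : ℕ}
    (f : Fin p → EuclideanSpace ℝ (Fin n) → ℝ)
    (C : Fin p → Set (EuclideanSpace ℝ (Fin n)))
    (hf : ∀ q, ConvexOn ℝ univ (f q))
    (hC_nonempty : ∀ q, (C q).Nonempty)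
    (hC_closed : ∀ q, IsClosed (C q))
    (hC_convex : ∀ q, Convex ℝ (C q))
    (hA : (SwitchingDescent.commonMinimizers f C).Nonempty)
    (σ : ℝ → Fin p)
    (hσ : SwitchingDescent.IsSwitchingSignal σ)
    (hσ_time : ∀ q, volume (SwitchingDescent.activeTimes σ q) = ⊤)
    (φ : ℝ → EuclideanSpace ℝ (Fin n))
    (hφ : SwitchingDescent.IsCompleteSolution f C σ φ) :
    ∃ a ∈ SwitchingDescent.commonMinimizers f C, Tendsto φ atTop (𝓝 a) := by
  obtain ⟨x, hx⟩ := hφ.exists_tendsto hf hC_closed hA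
  exact ⟨x, mem_iInter.2 fun q =>
    hφ.mem_argminOn_of_tendsto hf hC_closed hA hx (hσ_time q), hx⟩
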